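/- Let $\{0,1\}^*$ be the set of finite binary strings, and let $|p|$ denote the length of $p$. A \emph{prefix-free machine} is a partial recursive function $C\colon\{0,1\}^*\to\{0,1\}^*$ whose domain of definition $\operatorname{Dom} C$ is prefix-free (no element is a prefix of a different element). For such $C$ and $s\in\{0,1\}^*$ put $H_C(s)=\min\{|p| : C(p)=s\}\in\mathbb{N}\cup\{\infty\}$, and for $n\in\mathbb{N}=\{0,1,2,\dots\}$ put $S_C(n,s)=\{p\in\{0,1\}^* : |p|\le n,\ C(p)=s\}$. A prefix-free machine $U$ is \emph{optimal} if for each prefix-free machine $C$ there is $d\in\mathbb{N}$ such that for each $p\in\operatorname{Dom} C$ there is $q$ with $U(q)=C(p)$ and $|q|\le|p|+d$; then $H_U(s)<\infty$ for all $s$. Identify $\{0,1\}^*$ with $\mathbb{N}$ by letting a string $s$ correspond to the number whose binary expansion is $1s$, minus one. Fix an arbitrary optimal prefix-free machine $U$ and an arbitrary bijective total recursive function $b\colon\{0,1\}^*\times\{0,1\}^*\to\{0,1\}^*$, and write $H(n,s)=H_U(b(n,s))$ for $n\in\mathbb{N}$ and $s\in\{0,1\}^*$. \textbf{Theorem.}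 There exist an optimal prefix-free machine $V$ and $d\in\mathbb{N}$ such that \begin{enumerate} \item[(i)] $\#S_V(n,s)\le 2^{\,n-H(n,s)+d}$ for all $n\in\mathbb{N}$ and all $s\in\{0,1\}^*$, and \item[(ii)] $2^{\,n-H(n,s)-d}\le\#S_V(n,s)$ for all $n\in\mathbb{N}$ and all $s\in\{0,1\}^*$ with $n-H(n,s)\ge d$. \end{enumerate} -/

import Mathlib

namespace AIT

/-- The set `{0,1}*` of finite binary strings (`false` is the digit 0, `true` is the digit 1). -/
abbrev BinStr : Type := List Bool

/-- A set of strings is prefix-free if no element is a prefix of another element. -/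
def PrefixFree (S : Set BinStr) : Prop :=
  ∀ p ∈ S, ∀ q ∈ S, p <+: q → p = q

/-- A prefix-free machine: a partial recursive function `{0,1}* → {0,1}*` with prefix-free
domain of definition. -/
structure IsPrefixFreeMachine (C : BinStr →. BinStr) : Prop where
  partrec : Partrec C
  prefixFree : PrefixFree C.Dom

/-- A prefix-free machine `U` is optimal if for each prefix-free machine `C` there is `d` such
that for each `p ∈ Dom C` there is `q` with `U q = C p` and `|q| ≤ |p| + d`. -/
structure IsOptimal (U : BinStr →. BinStr) : Prop where
  machine : IsPrefixFreeMachine U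
  optimal : ∀ C : BinStr →. BinStr, IsPrefixFreeMachine C →
    ∃ d : ℕ, ∀ p ∈ C.Dom, ∃ q : BinStr, U q = C p ∧ q.length ≤ p.length + d

/-- The program-size complexity `H_C(s) = min {|p| : C(p) = s}`, equal to `⊤` if no `p` is
mapped to `s`. -/
noncomputable def complexity (C : BinStr →. BinStr) (s : BinStr) : ℕ∞ :=
  ⨅ p ∈ {p : BinStr | s ∈ C p}, (p.length : ℕ∞)

/-- The set `S_C(n,s) = {p : |p| ≤ n and C(p) = s}`. -/
def codewords (C : BinStr →. BinStr) (n : ℕ) (s : BinStr) : Set BinStr :=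
  {p | p.length ≤ n ∧ s ∈ C p}

/-- `S_C(n,s)` is finite, so that `Set.ncard` is its true cardinality. -/
theorem codewords_finite (C : BinStr →. BinStr) (n : ℕ) (s : BinStr) :
    (codewords C n s).Finite :=
  (List.finite_length_le Bool n).subset fun _ hp => hp.1

/-- The value of the string `s` read as a dyadic integer after the digits of `m`. -/
def readBits (m : ℕ) (s : BinStr) : ℕ := s.foldl (fun a x => 2 * a + x.toNat) m

theorem bits_readBits (s : BinStr) : (readBits 1 s).bits = s.reverse ++ [true] ∧
    readBits 1 s ≠ 0 := by
  induction s using List.reverseRecOn with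
  | nil => simp [readBits]
  | append_singleton s x ih =>
    have h : readBits 1 (s ++ [x]) = Nat.bit x (readBits 1 s) := by
      cases x <;> simp [readBits, Nat.bit]
    rw [h]
    refine ⟨?_, ?_⟩
    · rw [Nat.bits_append_bit _ _ (fun h0 => absurd h0 ih.2), ih.1]
      simp
    · have := ih.2
      cases x
      · simpa [Nat.bit] using this
      · simp [Nat.bit]

theorem readBits_bits (m : ℕ) (hm : m ≠ 0) : readBits 1 m.bits.dropLast.reverse = m := by
  induction m using Nat.binaryRec' with
  | zero => exact absurd rfl hm
  | bit x n h ih =>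
    rw [Nat.bits_append_bit _ _ h]
    by_cases hn : n = 0
    · subst hn
      have hx := h rfl
      subst hx
      simp [readBits, Nat.bit]
    · have hb : n.bits ≠ [] := by
        intro h0
        have h1 := ih hn
        rw [h0] at h1
        simp only [readBits, List.dropLast_nil, List.reverse_nil, List.foldl_nil] at h1
        subst h1
        simp at h0
      rw [List.dropLast_cons_of_ne_nil hb, List.reverse_cons]
      have h2 := ih hn
      unfold readBits at h2 ⊢
      rw [List.foldl_append, h2]
      cases x <;> simp [Nat.bit]

/-- The standard identification `φ : {0,1}* ≃ ℕ`, where `φ(s)` is the number with dyadic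
expansion `1s`, minus one. -/
def strEquivNat : BinStr ≃ ℕ where
  toFun s := readBits 1 s - 1
  invFun n := (n + 1).bits.dropLast.reverse
  left_inv s := by
    have h := bits_readBits s
    have h1 : readBits 1 s - 1 + 1 = readBits 1 s := by
      have := h.2
      omega
    change (readBits 1 s - 1 + 1).bits.dropLast.reverse = s
    rw [h1, h.1]
    simp
  right_inv n := by
    change readBits 1 (n + 1).bits.dropLast.reverse - 1 = n
    rw [readBits_bits (n + 1) (by omega)]
    rfl

/-- The machine that is defined on the empty string only, with value `s`. -/
theorem isPrefixFreeMachine_single (s : BinStr) :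
    IsPrefixFreeMachine (fun p => ((if p = [] then some s else none : Option BinStr) :
      Part BinStr)) where
  partrec := by
    have h : Primrec (fun p : BinStr => if p = [] then some s else (none : Option BinStr)) :=
      Primrec.ite (Primrec.eq.comp Primrec.id (Primrec.const [])) (Primrec.const _)
        (Primrec.const _)
    exact h.to_comp.ofOption
  prefixFree := by
    have key : ∀ p : BinStr, p ∈ PFun.Dom (fun p : BinStr =>
        ((if p = [] then some s else none : Option BinStr) : Part BinStr)) → p = [] := by
      intro p hp
      by_contra hne
      simp [PFun.Dom, hne] at hp
    intro p hp q hq _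
    rw [key p hp, key q hq]

/-- For an optimal machine the complexity is a natural number, and the minimum is attained. -/
theorem IsOptimal.exists_length_eq_complexity {U : BinStr →. BinStr} (hU : IsOptimal U)
    (s : BinStr) : ∃ p : BinStr, s ∈ U p ∧ complexity U s = p.length := by
  have hne : {p : BinStr | s ∈ U p}.Nonempty := by
    obtain ⟨d, hd⟩ := hU.optimal _ (isPrefixFreeMachine_single s)
    obtain ⟨q, hq, -⟩ := hd [] (by simp [PFun.Dom])
    exact ⟨q, by simp [hq]⟩
  obtain ⟨p, hp, hmin⟩ := (measure List.length).wf.has_min _ hne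
  exact ⟨p, hp, le_antisymm (iInf₂_le p hp) (le_iInf₂ fun q hq => by
    have h : ¬ q.length < p.length := hmin q hq
    exact_mod_cast not_lt.mp h)⟩

/-- The complexity of a pair, `H_U(n,s) = H_U(b(n,s))`, as a natural number; `b` is the chosen
bijective coding of pairs of strings and `n` is identified with a string. -/
noncomputable def pairComplexity (U : BinStr →. BinStr) (b : BinStr × BinStr → BinStr)
    (n : ℕ) (s : BinStr) : ℕ :=
  (complexity U (b (strEquivNat.symm n, s))).toNat

/-- Whether two strings are distinct and one of them is a prefix of the other. -/
def comparable (q p : BinStr) : Bool :=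
  !decide (q = p) && (decide (q.take p.length = p) || decide (p.take q.length = q))

theorem primrec_comparable : Primrec₂ comparable := by
  have h : Primrec₂ fun q p : BinStr => decide (q = p) := Primrec.eq.decide
  exact Primrec.and.comp (Primrec.not.comp (h.comp Primrec.fst Primrec.snd))
    (Primrec.or.comp
      (h.comp (Primrec.list_take.comp (Primrec.list_length.comp Primrec.snd)
        Primrec.fst) Primrec.snd)
      (h.comp (Primrec.list_take.comp (Primrec.list_length.comp Primrec.fst)
        Primrec.snd) Primrec.fst))

/-- Whether `j` codes a string comparable with, but distinct from, `p`, and the program `c` halts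
on it within `k` steps. -/
def clash (a : ℕ × Nat.Partrec.Code × BinStr) (j : ℕ) : Bool :=
  (Nat.Partrec.Code.evaln a.1 a.2.1 j).isSome &&
    ((Encodable.decode j : Option BinStr).map fun q =>
      (Encodable.encode q == j) && comparable q a.2.2).getD false

theorem primrec_clash : Primrec₂ clash := by
  refine Primrec.and.comp (Primrec.option_isSome.comp
    (Nat.Partrec.Code.primrec_evaln.comp
      (((Primrec.fst.comp Primrec.fst).pair
        (Primrec.fst.comp (Primrec.snd.comp Primrec.fst))).pair Primrec.snd))) ?_
  refine Primrec.option_getD.comp ?_ (Primrec.const false)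
  refine Primrec.option_map (Primrec.decode.comp Primrec.snd) ?_
  exact Primrec.and.comp
    (Primrec.beq.comp (Primrec.encode.comp Primrec.snd) (Primrec.snd.comp Primrec.fst))
    (primrec_comparable.comp Primrec.snd
      (Primrec.snd.comp (Primrec.snd.comp (Primrec.fst.comp Primrec.fst))))

/-- The output of program `c` on `p` after `k` steps, discarded if there is a clash. -/
def guarded (a : ℕ × Nat.Partrec.Code × BinStr) : Option BinStr :=
  if ∀ j < a.1, clash a j = false then
    (Nat.Partrec.Code.evaln a.1 a.2.1 (Encodable.encode a.2.2)).bind Encodable.decode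
  else none

theorem primrec_guarded : Primrec guarded := by
  have h1 : PrimrecRel fun (j : ℕ) (a : ℕ × Nat.Partrec.Code × BinStr) => clash a j = false :=
    Primrec.eq.comp₂ primrec_clash.swap (Primrec₂.const false)
  have h3 : PrimrecPred fun a : ℕ × Nat.Partrec.Code × BinStr =>
      ∀ j ∈ List.range a.1, clash a j = false :=
    h1.forall_mem_list.comp (Primrec.list_range.comp Primrec.fst) Primrec.id
  have h2 : PrimrecPred fun a : ℕ × Nat.Partrec.Code × BinStr =>
      ∀ j < a.1, clash a j = false := h3.of_eq fun a => by simp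
  refine Primrec.ite h2 ?_ (Primrec.const none)
  exact Primrec.option_bind (Nat.Partrec.Code.primrec_evaln.comp
    ((Primrec.fst.pair (Primrec.fst.comp Primrec.snd)).pair
      (Primrec.encode.comp (Primrec.snd.comp Primrec.snd)))) (Primrec.decode.comp Primrec.snd)

/-- The program `c` run on strings, restricted to a prefix-free domain. -/
def restricted (x : Nat.Partrec.Code × BinStr) : Part BinStr :=
  (Nat.rfind fun k => Part.some
    (Nat.Partrec.Code.evaln k x.1 (Encodable.encode x.2)).isSome).bind
      fun k => (guarded (k, x) : Part BinStr)

theorem partrec_restricted : Partrec restricted := by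
  have h1 : Primrec₂ fun (x : Nat.Partrec.Code × BinStr) (k : ℕ) =>
      (Nat.Partrec.Code.evaln k x.1 (Encodable.encode x.2)).isSome :=
    Primrec.option_isSome.comp (Nat.Partrec.Code.primrec_evaln.comp
      ((Primrec.snd.pair (Primrec.fst.comp Primrec.fst)).pair
        (Primrec.encode.comp (Primrec.snd.comp Primrec.fst))))
  have h2 : Primrec₂ fun (x : Nat.Partrec.Code × BinStr) (k : ℕ) => guarded (k, x) :=
    primrec_guarded.comp (Primrec.snd.pair Primrec.fst)
  exact (Partrec.rfind h1.to_comp.partrec₂).bind (Computable.ofOption h2.to_comp)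

theorem restricted_dom {c : Nat.Partrec.Code} {p : BinStr} (h : (restricted (c, p)).Dom) :
    ∃ k, (Nat.Partrec.Code.evaln k c (Encodable.encode p)).isSome = true ∧
      ∀ q : BinStr, q ≠ p → (p <+: q ∨ q <+: p) →
        (Nat.Partrec.Code.evaln k c (Encodable.encode q)).isSome = false := by
  obtain ⟨s, hs⟩ := Part.dom_iff_mem.mp h
  obtain ⟨k, hk, hg⟩ := Part.mem_bind_iff.mp hs
  refine ⟨k, by simpa using Nat.rfind_spec hk, fun q hqp hpq => ?_⟩
  by_contra hne
  have hq : (Nat.Partrec.Code.evaln k c (Encodable.encode q)).isSome = true := by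
    rwa [Bool.not_eq_false] at hne
  obtain ⟨y, hy⟩ := Option.isSome_iff_exists.mp hq
  have hlt : Encodable.encode q < k := Nat.Partrec.Code.evaln_bound hy
  have hcl : clash (k, c, p) (Encodable.encode q) = true := by
    rcases hpq with h1 | h1
    · simp [clash, comparable, hq, hqp, (List.prefix_iff_eq_take.mp h1).symm]
    · simp [clash, comparable, hq, hqp, (List.prefix_iff_eq_take.mp h1).symm]
  have : guarded (k, c, p) = none := by
    unfold guarded
    rw [if_neg]
    intro hall
    have := hall _ hlt
    simp [hcl] at this
  simp [this] at hg

theorem restricted_prefixFree {c : Nat.Partrec.Code} {p q : BinStr}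
    (hp : (restricted (c, p)).Dom) (hq : (restricted (c, q)).Dom) (h : p <+: q) : p = q := by
  by_contra hne
  obtain ⟨k, hk, hk'⟩ := restricted_dom hp
  obtain ⟨l, hl, hl'⟩ := restricted_dom hq
  obtain ⟨y, hy⟩ := Option.isSome_iff_exists.mp hk
  obtain ⟨z, hz⟩ := Option.isSome_iff_exists.mp hl
  rcases le_total k l with hkl | hkl
  · have h1 := hl' p hne (Or.inr h)
    rw [Option.mem_def.mp (Nat.Partrec.Code.evaln_mono hkl hy)] at h1
    simp at h1
  · have h1 := hk' q (Ne.symm hne) (Or.inl h)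
    rw [Option.mem_def.mp (Nat.Partrec.Code.evaln_mono hkl hz)] at h1
    simp at h1

theorem restricted_eq {C : BinStr →. BinStr} (hC : PrefixFree C.Dom) {c : Nat.Partrec.Code}
    (hc : ∀ p : BinStr, c.eval (Encodable.encode p) = (C p).map Encodable.encode)
    {p s : BinStr} (hs : s ∈ C p) : s ∈ restricted (c, p) := by
  have hdom : ∀ k (q : BinStr), (Nat.Partrec.Code.evaln k c (Encodable.encode q)).isSome = true →
      q ∈ C.Dom := by
    intro k q hq
    obtain ⟨y, hy⟩ := Option.isSome_iff_exists.mp hq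
    have h1 := Nat.Partrec.Code.evaln_sound hy
    rw [hc] at h1
    obtain ⟨t, ht, -⟩ := (Part.mem_map_iff _).mp h1
    exact Part.dom_iff_mem.mpr ⟨t, ht⟩
  have h0 : Encodable.encode s ∈ c.eval (Encodable.encode p) := by
    rw [hc]
    exact Part.mem_map _ hs
  obtain ⟨k0, hk0⟩ := Nat.Partrec.Code.evaln_complete.mp h0
  have hd : (Nat.rfind fun k => Part.some
      (Nat.Partrec.Code.evaln k c (Encodable.encode p)).isSome).Dom := by
    refine Nat.rfind_dom.mpr ?_
    exact ⟨k0, by simp [Option.mem_def.mp hk0], fun _ => trivial⟩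
  obtain ⟨k, hk⟩ := Part.dom_iff_mem.mp hd
  have hk1 : (Nat.Partrec.Code.evaln k c (Encodable.encode p)).isSome = true := by
    simpa using Nat.rfind_spec hk
  obtain ⟨y, hy⟩ := Option.isSome_iff_exists.mp hk1
  have hys : y = Encodable.encode s := Part.mem_unique (Nat.Partrec.Code.evaln_sound hy) h0
  refine Part.mem_bind_iff.mpr ⟨k, hk, ?_⟩
  have hcl : ∀ j < k, clash (k, c, p) j = false := by
    intro j _
    by_contra hne
    have hj : clash (k, c, p) j = true := by simpa using hne
    unfold clash at hj
    rw [Bool.and_eq_true] at hj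
    obtain ⟨hj1, hj2⟩ := hj
    cases hq : (Encodable.decode j : Option BinStr) with
    | none => simp [hq] at hj2
    | some q =>
      simp only [hq, Option.map_some, Option.getD_some, comparable, Bool.and_eq_true,
        Bool.or_eq_true, beq_iff_eq, Bool.not_eq_true', decide_eq_true_eq,
        decide_eq_false_iff_not] at hj2
      have hqd := hdom k q (by rw [hj2.1]; exact hj1)
      have hpd := hdom k p hk1
      rcases hj2.2.2 with h1 | h1
      · exact hj2.2.1 (hC p hpd q hqd (List.prefix_iff_eq_take.mpr h1.symm)).symm
      · exact hj2.2.1 (hC q hqd p hpd (List.prefix_iff_eq_take.mpr h1.symm))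
  have : guarded (k, c, p) = some s := by
    unfold guarded
    rw [if_pos hcl]
    simp [hy, hys]
  simp [this]

/-- Splits `0^i 1 p` into `i` and `p`. -/
def parse (r : BinStr) : Option (ℕ × BinStr) :=
  List.recOn (motive := fun _ => Option (ℕ × BinStr)) r none fun x l ih =>
    bif x then some (0, l) else ih.map fun y => (y.1 + 1, y.2)

theorem primrec_parse : Primrec parse := by
  refine Primrec.list_rec (h := fun (_ : BinStr) (x : Bool × BinStr × Option (ℕ × BinStr)) =>
    bif x.1 then some (0, x.2.1) else x.2.2.map fun y => (y.1 + 1, y.2))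
    Primrec.id (Primrec.const none) ?_
  refine Primrec.cond (Primrec.fst.comp Primrec.snd) ?_ ?_
  · exact Primrec.option_some.comp
      ((Primrec.const 0).pair (Primrec.fst.comp (Primrec.snd.comp Primrec.snd)))
  · exact Primrec.option_map (Primrec.snd.comp (Primrec.snd.comp Primrec.snd))
      ((Primrec.succ.comp (Primrec.fst.comp Primrec.snd)).pair (Primrec.snd.comp Primrec.snd))

theorem parse_prefix : ∀ (r r' : BinStr) (x x' : ℕ × BinStr), r <+: r' → parse r = some x →
    parse r' = some x' → x.1 = x'.1 ∧ x.2 <+: x'.2 ∧ (x.2 = x'.2 → r = r') := by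
  intro r
  induction r with
  | nil => intro r' x x' _ h; simp [parse] at h
  | cons a r ih =>
    intro r' x x' hpre h h'
    obtain ⟨t, rfl⟩ := hpre
    cases a with
    | true =>
      simp only [parse, List.cons_append, cond_true, Option.some.injEq] at h h'
      subst h
      subst h'
      simp
    | false =>
      change (parse r).map _ = _ at h
      change (parse (r ++ t)).map _ = _ at h'
      obtain ⟨y, hy, rfl⟩ := Option.map_eq_some_iff.mp h
      obtain ⟨y', hy', rfl⟩ := Option.map_eq_some_iff.mp h'
      obtain ⟨h1, h2, h3⟩ := ih _ y y' ⟨t, rfl⟩ hy hy'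
      exact ⟨by simp [h1], h2, fun h4 => by simpa using h3 h4⟩

theorem parse_replicate (i : ℕ) (p : BinStr) :
    parse (List.replicate i false ++ true :: p) = some (i, p) := by
  induction i with
  | zero => rfl
  | succ i ih =>
    change (parse (List.replicate i false ++ true :: p)).map _ = _
    rw [ih]
    rfl

/-- Optimal prefix-free machines exist. -/
theorem exists_isOptimal : ∃ U : BinStr →. BinStr, IsOptimal U := by
  let U : BinStr →. BinStr := fun r => (parse r : Part (ℕ × BinStr)).bind fun x =>
    restricted (Denumerable.ofNat Nat.Partrec.Code x.1, x.2)
  have hmem : ∀ r s, s ∈ U r → ∃ x, parse r = some x ∧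
      s ∈ restricted (Denumerable.ofNat Nat.Partrec.Code x.1, x.2) := by
    intro r s h
    obtain ⟨x, hx, hs⟩ := Part.mem_bind_iff.mp h
    exact ⟨x, by simpa using hx, hs⟩
  refine ⟨U, ⟨?_, ?_⟩, ?_⟩
  · refine Partrec.bind primrec_parse.to_comp.ofOption ?_
    exact partrec_restricted.comp
      (((Primrec.ofNat Nat.Partrec.Code).comp (Primrec.fst.comp Primrec.snd)).pair
        (Primrec.snd.comp Primrec.snd)).to_comp
  · intro r hr r' hr' hpre
    obtain ⟨s, hs⟩ := Part.dom_iff_mem.mp hr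
    obtain ⟨s', hs'⟩ := Part.dom_iff_mem.mp hr'
    obtain ⟨x, hx, hxs⟩ := hmem _ _ hs
    obtain ⟨x', hx', hxs'⟩ := hmem _ _ hs'
    obtain ⟨h1, h2, h3⟩ := parse_prefix r r' x x' hpre hx hx'
    rw [← h1] at hxs'
    exact h3 (restricted_prefixFree (Part.dom_iff_mem.mpr ⟨_, hxs⟩)
      (Part.dom_iff_mem.mpr ⟨_, hxs'⟩) h2)
  · intro C hC
    obtain ⟨c, hc⟩ := Nat.Partrec.Code.exists_code.mp hC.partrec
    have hc' : ∀ p : BinStr, c.eval (Encodable.encode p) = (C p).map Encodable.encode := by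
      intro p
      rw [hc]
      simp
    refine ⟨Encodable.encode c + 1, fun p hp => ?_⟩
    obtain ⟨s, hs⟩ := Part.dom_iff_mem.mp hp
    refine ⟨List.replicate (Encodable.encode c) false ++ true :: p, ?_, ?_⟩
    · rw [Part.eq_some_iff.mpr hs, Part.eq_some_iff]
      refine Part.mem_bind_iff.mpr ⟨(Encodable.encode c, p), by simp [parse_replicate], ?_⟩
      simpa using restricted_eq hC.prefixFree hc' hs
    · simp
      omega

end AIT

open AIT

/-!
The upper bound holds for every prefix-free machine `V` and is a case of the coding theorem. By
Kraft's inequality the numbers `#S_V(n, s) 2^{-n-1}` have sum at most one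
(`tsum_ncard_codewords_le_one`), since a program `p` contributes `2^{-n-1}` for each `n ≥ |p|`.
They can be enumerated from below: whenever the `2^k`-th program of length at most `n` for `s` turns
up, a program of length about `n - k` is requested for the pair `(n, s)`. For fixed `(n, s)` these
requests form a geometric series, so their total weight is again at most one, and a prefix-free
machine fulfills them all (`exists_machine_of_requests`). Optimality of `U` then bounds `H(n, s)`
by `n - k + O(1)`, where `2^k` is the order of magnitude of `#S_V(n, s)`.

To fulfill requests of weights `2^{-l}` it is enough to lay half-open intervals of these lengths
side by side in `[0, 1)` in the order of enumeration. The interval of length `2^{-l}` contains a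
dyadic interval of length `2^{-l-1}`, that is, the set of all reals whose expansion begins with a
certain string of length `l + 1`, and this string is the program. Disjoint dyadic intervals
belong to incomparable strings.

For the lower bound, programs are padded (`exists_padded_machine`). The machine `V` runs `U` on the
inputs `0p`, which makes it optimal. If `U(p)` codes the pair `(n, s)`, then `V` outputs `s` on all
inputs `1px` of length `n`. For a shortest such `p` these are `2^{n-1-H(n,s)}` programs for `s`.
-/

open AIT

namespace AIT

open scoped ENNReal NNReal

/-! ### Prefix-free sets and dyadic intervals -/

theorem PrefixFree.uniquelyDecodable {S : Set BinStr} (hS : PrefixFree S) (h0 : [] ∉ S) :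
    InformationTheory.UniquelyDecodable S := by
  intro L₁
  induction L₁ with
  | nil =>
    intro L₂ _ h₂ h
    cases L₂ with
    | nil => rfl
    | cons b L₂ =>
      have hb : b = [] := by
        have : b ++ L₂.flatten = [] := by simpa using h.symm
        exact (List.append_eq_nil_iff.mp this).1
      exact absurd (hb ▸ h₂ b (by simp)) h0
  | cons a L₁ ih =>
    intro L₂ h₁ h₂ h
    cases L₂ with
    | nil =>
      have ha : a = [] := by
        have : a ++ L₁.flatten = [] := by simpa using h
        exact (List.append_eq_nil_iff.mp this).1
      exact absurd (ha ▸ h₁ a (by simp)) h0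
    | cons b L₂ =>
      simp only [List.flatten_cons] at h
      have ha := h₁ a (by simp)
      have hb := h₂ b (by simp)
      have hab : a = b := by
        rcases List.prefix_or_prefix_of_prefix (List.prefix_append a L₁.flatten)
          (h ▸ List.prefix_append b L₂.flatten) with h' | h'
        · exact hS a ha b hb h'
        · exact (hS b hb a ha h').symm
      subst hab
      rw [ih L₂ (fun w hw => h₁ w (by simp [hw])) (fun w hw => h₂ w (by simp [hw]))
        (List.append_cancel_left h)]

theorem PrefixFree.mono {S T : Set BinStr} (hT : PrefixFree T) (h : S ⊆ T) : PrefixFree S :=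
  fun p hp q hq => hT p (h hp) q (h hq)

theorem PrefixFree.sum_le_one {F : Finset BinStr} (hF : PrefixFree (F : Set BinStr)) :
    ∑ p ∈ F, (2⁻¹ : ℝ) ^ p.length ≤ 1 := by
  by_cases h0 : [] ∈ F
  · -- The empty string is a prefix of every string, so `F` is a singleton.
    have : F = {[]} := Finset.eq_singleton_iff_unique_mem.mpr
      ⟨h0, fun p hp => (hF [] h0 p hp List.nil_prefix).symm⟩
    simp [this]
  · simpa using InformationTheory.kraft_mcmillan_inequality
      (hF.uniquelyDecodable (by simpa using h0))

/-- Kraft's inequality for a possibly infinite prefix-free set of strings. -/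
theorem PrefixFree.tsum_le_one {S : Set BinStr} (hS : PrefixFree S) :
    ∑' p, S.indicator (fun p : BinStr => (2⁻¹ : ℝ≥0∞) ^ p.length) p ≤ 1 := by
  classical
  rw [ENNReal.tsum_eq_iSup_sum]
  refine iSup_le fun F => ?_
  have h1 : ∑ p ∈ F, S.indicator (fun p : BinStr => (2⁻¹ : ℝ≥0∞) ^ p.length) p
      = ∑ p ∈ F.filter (· ∈ S), (2⁻¹ : ℝ≥0∞) ^ p.length := by
    rw [Finset.sum_filter]
    rfl
  have h2 : ∑ p ∈ F.filter (· ∈ S), (2⁻¹ : ℝ≥0∞) ^ p.length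
      = ENNReal.ofReal (∑ p ∈ F.filter (· ∈ S), (2⁻¹ : ℝ) ^ p.length) := by
    rw [ENNReal.ofReal_sum_of_nonneg fun _ _ => by positivity]
    refine Finset.sum_congr rfl fun p _ => ?_
    rw [ENNReal.ofReal_pow (by norm_num), ENNReal.ofReal_inv_of_pos (by norm_num)]
    simp
  rw [h1, h2, ENNReal.ofReal_le_one]
  exact PrefixFree.sum_le_one (hS.mono fun p hp => by simp at hp; exact hp.2)

theorem readBits_append (m : ℕ) (s t : BinStr) :
    readBits m (s ++ t) = readBits (readBits m s) t := by
  simp [readBits]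

theorem readBits_eq (m : ℕ) (s : BinStr) : readBits m s = m * 2 ^ s.length + readBits 0 s := by
  induction s generalizing m with
  | nil => simp [readBits]
  | cons x s ih =>
    change readBits (2 * m + x.toNat) s = _ + readBits (2 * 0 + x.toNat) s
    rw [ih, ih (2 * 0 + x.toNat), List.length_cons, pow_succ]
    ring

theorem readBits_zero_lt (s : BinStr) : readBits 0 s < 2 ^ s.length := by
  induction s with
  | nil => simp [readBits]
  | cons x s ih =>
    change readBits (2 * 0 + x.toNat) s < _
    rw [readBits_eq, List.length_cons, pow_succ]
    have : x.toNat ≤ 1 := by cases x <;> simp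
    nlinarith [Nat.mul_le_mul_right (2 ^ s.length) this]

theorem exists_readBits_eq (l x : ℕ) (hx : x < 2 ^ l) :
    ∃ p : BinStr, p.length = l ∧ readBits 0 p = x := by
  induction l generalizing x with
  | zero => exact ⟨[], rfl, by simp at hx; simp [readBits, hx]⟩
  | succ l ih =>
    obtain ⟨p, hp, hpx⟩ := ih (x / 2) (by rw [pow_succ] at hx; omega)
    refine ⟨p ++ [decide (x % 2 = 1)], by simp [hp], ?_⟩
    rw [readBits_append, hpx]
    rcases Nat.mod_two_eq_zero_or_one x with h | h <;> simp [readBits, h] <;> omega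

theorem primrec_readBits_zero : Primrec (readBits 0) := by
  refine (Primrec.list_foldl (h := fun (_ : BinStr) (y : ℕ × Bool) => 2 * y.1 + y.2.toNat)
    Primrec.id (Primrec.const 0) ?_).of_eq fun s => rfl
  exact Primrec.nat_add.comp
    (Primrec.nat_mul.comp (Primrec.const 2) (Primrec.fst.comp Primrec.snd))
    ((Primrec.dom_bool Bool.toNat).comp (Primrec.snd.comp Primrec.snd))

/-- The left end of the dyadic interval `[0.p, 0.p + 2^{-|p|})` of reals whose binary expansion
begins with the digits of `p`. -/
noncomputable def leftEnd (p : BinStr) : ℝ := readBits 0 p * (2⁻¹ : ℝ) ^ p.length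

theorem leftEnd_append (p t : BinStr) :
    leftEnd (p ++ t) = leftEnd p + (2⁻¹ : ℝ) ^ p.length * leftEnd t := by
  have h : ((2 : ℝ) ^ t.length) * 2⁻¹ ^ t.length = 1 := by rw [← mul_pow]; norm_num
  unfold leftEnd
  rw [readBits_append, readBits_eq, List.length_append, pow_add]
  push_cast
  linear_combination (readBits 0 p : ℝ) * 2⁻¹ ^ p.length * h

theorem leftEnd_nonneg (p : BinStr) : 0 ≤ leftEnd p := by
  unfold leftEnd
  positivity

theorem leftEnd_lt_one (p : BinStr) : leftEnd p < 1 := by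
  unfold leftEnd
  rw [inv_pow, ← div_eq_mul_inv, div_lt_one (by positivity)]
  exact_mod_cast readBits_zero_lt p

theorem leftEnd_of_prefix {p q : BinStr} (h : p <+: q) :
    leftEnd p ≤ leftEnd q ∧ leftEnd q < leftEnd p + (2⁻¹ : ℝ) ^ p.length := by
  obtain ⟨t, rfl⟩ := h
  rw [leftEnd_append]
  have h0 := leftEnd_nonneg t
  have h1 := leftEnd_lt_one t
  have h2 : (0 : ℝ) < 2⁻¹ ^ p.length := by positivity
  constructor <;> nlinarith

/-! ### Computability tools -/

theorem mem_rfindOpt_of_unique {α : Type*} {f : ℕ → Option α} {a : α} {n : ℕ} (h : a ∈ f n)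
    (hu : ∀ m x, x ∈ f m → x = a) : a ∈ Nat.rfindOpt f := by
  obtain ⟨x, hx⟩ := Part.dom_iff_mem.mp (Nat.rfindOpt_dom.mpr ⟨n, a, h⟩)
  obtain ⟨m, hm⟩ := Nat.rfindOpt_spec hx
  exact hu m x hm ▸ hx

/-- The inverse of a computable bijection is computable: it is found by exhaustive search. -/
theorem computable_symm {α β : Type*} [Primcodable α] [Primcodable β] [DecidableEq β]
    (e : α ≃ β) (he : Computable e) : Computable e.symm := by
  have hf : Computable₂ fun (y : β) (n : ℕ) =>
      (Encodable.decode n : Option α).bind fun x => if e x = y then some x else none := by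
    refine Computable.option_bind (Computable.decode.comp Computable.snd) ?_
    have h : Computable fun a : (β × ℕ) × α => decide (e a.2 = a.1.1) :=
      Primrec.eq.decide.to_comp.comp (he.comp Computable.snd)
        (Computable.fst.comp Computable.fst)
    exact (Computable.cond h (Computable.option_some.comp Computable.snd)
      (Computable.const none)).of_eq fun a => by
        by_cases h : e a.2 = a.1.1 <;> simp [h]
  refine (Partrec.rfindOpt hf).of_eq_tot fun y => ?_
  refine mem_rfindOpt_of_unique (n := Encodable.encode (e.symm y)) (by simp) ?_
  intro m x hx
  simp only [Option.mem_def, Option.bind_eq_some_iff, Option.ite_none_right_eq_some] at hx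
  obtain ⟨z, -, hz, hzx⟩ := hx
  rw [← hz, Equiv.symm_apply_apply]
  simpa using hzx.symm

/-- The graph of a partial recursive function has a repetition-free primitive recursive
enumeration: the index codes an argument together with its exact halting time. -/
theorem exists_primrec_enumeration {α β : Type*} [Primcodable α] [Primcodable β] {C : α →. β}
    (hC : Partrec C) : ∃ e : ℕ → Option (α × β), Primrec e ∧
      (∀ p s, s ∈ C p ↔ ∃ i, e i = some (p, s)) ∧
      ∀ i j x, e i = some x → e j = some x → i = j := by
  obtain ⟨c, hc⟩ := Nat.Partrec.Code.exists_code.mp hC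
  have hc' : ∀ p : α, c.eval (Encodable.encode p) = (C p).map Encodable.encode := by
    intro p
    rw [hc]
    simp
  let e : ℕ → Option (α × β) := fun i =>
    (Encodable.decode₂ α i.unpair.1).bind fun p =>
      if Nat.Partrec.Code.evaln i.unpair.2 c i.unpair.1 = none then
        ((Nat.Partrec.Code.evaln (i.unpair.2 + 1) c i.unpair.1).bind
          (Encodable.decode (α := β))).map fun s => (p, s)
      else none
  have hmem : ∀ i p s, e i = some (p, s) ↔ Encodable.encode p = i.unpair.1 ∧
      Nat.Partrec.Code.evaln i.unpair.2 c i.unpair.1 = none ∧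
      Nat.Partrec.Code.evaln (i.unpair.2 + 1) c i.unpair.1 = some (Encodable.encode s) := by
    intro i p s
    constructor
    · intro h
      simp only [e, Option.bind_eq_some_iff, Option.ite_none_right_eq_some, Option.map_eq_some_iff,
        Prod.mk.injEq] at h
      obtain ⟨p', hp', h1, s', ⟨y, hy, hys⟩, rfl, rfl⟩ := h
      have hp := Encodable.decode₂_eq_some.mp hp'
      refine ⟨hp, h1, ?_⟩
      have := Nat.Partrec.Code.evaln_sound hy
      rw [← hp, hc'] at this
      obtain ⟨t, -, rfl⟩ := (Part.mem_map_iff _).mp this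
      rw [Encodable.encodek, Option.some.injEq] at hys
      rw [hy, hys]
    · rintro ⟨h0, h1, h2⟩
      simp only [e, Option.bind_eq_some_iff, Option.ite_none_right_eq_some, Option.map_eq_some_iff]
      exact ⟨p, Encodable.decode₂_eq_some.mpr h0, h1, s, ⟨_, h2, Encodable.encodek s⟩, rfl⟩
  have hev : ∀ k : ℕ → ℕ, Primrec k →
      Primrec fun i : ℕ => Nat.Partrec.Code.evaln (k i) c i.unpair.1 := fun k hk =>
    Nat.Partrec.Code.primrec_evaln.comp
      ((hk.pair (Primrec.const c)).pair (Primrec.fst.comp Primrec.unpair))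
  have ht : Primrec fun i : ℕ => i.unpair.2 := Primrec.snd.comp Primrec.unpair
  refine ⟨e, ?_, ?_, ?_⟩
  · refine Primrec.option_bind (Primrec.decode₂.comp (Primrec.fst.comp Primrec.unpair)) ?_
    refine Primrec.ite (Primrec.eq.comp ((hev _ ht).comp Primrec.fst) (Primrec.const none)) ?_
      (Primrec.const none)
    refine Primrec.option_map (Primrec.option_bind
      ((hev _ (Primrec.succ.comp ht)).comp Primrec.fst) (Primrec.decode.comp Primrec.snd)) ?_
    exact (Primrec.snd.comp Primrec.fst).pair Primrec.snd
  · intro p s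
    constructor
    · intro hs
      have h0 : Encodable.encode s ∈ c.eval (Encodable.encode p) := by
        rw [hc']
        exact Part.mem_map _ hs
      have hex := Nat.Partrec.Code.evaln_complete.mp h0
      classical
      obtain ⟨t, ht⟩ : ∃ t, Nat.find hex = t + 1 := Nat.exists_eq_succ_of_ne_zero fun hz => by
        have := Nat.find_spec hex
        rw [hz] at this
        simp [Nat.Partrec.Code.evaln] at this
      refine ⟨Nat.pair (Encodable.encode p) t, (hmem _ _ _).mpr ?_⟩
      simp only [Nat.unpair_pair, true_and]
      refine ⟨?_, ht ▸ Nat.find_spec hex⟩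
      by_contra hne
      obtain ⟨y, hy⟩ := Option.ne_none_iff_exists'.mp hne
      have hy0 : y = Encodable.encode s :=
        Part.mem_unique (Nat.Partrec.Code.evaln_sound hy) h0
      exact Nat.find_min hex (m := t) (by omega) (hy0 ▸ hy)
    · rintro ⟨i, hi⟩
      obtain ⟨h0, -, h2⟩ := (hmem _ _ _).mp hi
      have := Nat.Partrec.Code.evaln_sound h2
      rw [← h0, hc'] at this
      obtain ⟨t, ht, hts⟩ := (Part.mem_map_iff _).mp this
      exact Encodable.encode_injective hts ▸ ht
  · rintro i j ⟨p, s⟩ hi hj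
    obtain ⟨h0, h1, h2⟩ := (hmem _ _ _).mp hi
    obtain ⟨h0', h1', h2'⟩ := (hmem _ _ _).mp hj
    have key : ∀ i j : ℕ, i.unpair.1 = j.unpair.1 →
        Nat.Partrec.Code.evaln (i.unpair.2 + 1) c i.unpair.1 = some (Encodable.encode s) →
        Nat.Partrec.Code.evaln j.unpair.2 c j.unpair.1 = none → j.unpair.2 ≤ i.unpair.2 := by
      intro i j hij hi hj
      by_contra hlt
      have := Nat.Partrec.Code.evaln_mono (k₂ := j.unpair.2) (by omega) hi
      rw [hij, Option.mem_def, hj] at this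
      simp at this
    have h12 := h0.symm.trans h0'
    rw [← Nat.pair_unpair i, ← Nat.pair_unpair j, h12,
      le_antisymm (key j i h12.symm h2' h1) (key i j h12 h2 h1')]

/-! ### Machines from requests -/

/-- The weight `2^{-l}` of a request `(l, s)`, which asks for a program of length about `l` with
output `s`; the absent request has weight `0`. -/
noncomputable def requestWeight (x : Option (ℕ × BinStr)) : ℝ≥0 :=
  x.elim 0 fun y => 2⁻¹ ^ y.1

@[simp] theorem requestWeight_none : requestWeight none = 0 := rfl

@[simp] theorem requestWeight_some (y : ℕ × BinStr) : requestWeight (some y) = 2⁻¹ ^ y.1 := rfl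

/-- The numerator and the denominator of `a.1 / a.2` plus the weight of the request `x`. -/
def addRequest (a : ℕ × ℕ) (x : Option (ℕ × BinStr)) : ℕ × ℕ :=
  x.casesOn a fun y => (a.1 * 2 ^ y.1 + a.2, a.2 * 2 ^ y.1)

/-- The numerator and the denominator of the total weight of the requests with index below `i`. -/
def partialWeight (r : ℕ → Option (ℕ × BinStr)) : ℕ → ℕ × ℕ
  | 0 => (0, 1)
  | i + 1 => addRequest (partialWeight r i) (r i)

/-- For the fraction `a.1 / a.2`, the least `x` with `a.1 / a.2 ≤ x / 2^{l+1}`; the string of length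
`l + 1` with value `x` is allocated to a request `(l, s)`. -/
def allocated (a : ℕ × ℕ) (l : ℕ) : ℕ := (a.1 * 2 ^ (l + 1) + a.2 - 1) / a.2

/-- The output `y.2` of the request `y`, if `p` is the string that is allocated to `y` when the
earlier requests have total weight `a.1 / a.2`. -/
def allocatedOutput (p : BinStr) (a : ℕ × ℕ) (y : ℕ × BinStr) : Option BinStr :=
  if p.length = y.1 + 1 ∧ readBits 0 p = allocated a y.1 then some y.2 else none

/-- The output for `p` according to the request with index `i`, if `p` is the string that
is allocated to this request. -/
def requestOutput (r : ℕ → Option (ℕ × BinStr)) (p : BinStr) (i : ℕ) : Option BinStr :=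
  (r i).bind (allocatedOutput p (partialWeight r i))

theorem primrec_two_pow : Primrec fun n : ℕ => 2 ^ n :=
  (Primrec.nat_rec₁ (f := fun _ y => 2 * y) 1
    (Primrec.nat_mul.comp (Primrec.const 2) Primrec.snd)).of_eq fun n => by
      induction n with
      | zero => rfl
      | succ n ih => rw [pow_succ, ← ih, mul_comm]

theorem primrec_allocated : Primrec₂ allocated := by
  have h1 : Primrec fun x : (ℕ × ℕ) × ℕ => x.1.1 := Primrec.fst.comp Primrec.fst
  have h2 : Primrec fun x : (ℕ × ℕ) × ℕ => x.1.2 := Primrec.snd.comp Primrec.fst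
  have h3 : Primrec fun x : (ℕ × ℕ) × ℕ => 2 ^ (x.2 + 1) :=
    primrec_two_pow.comp (Primrec.succ.comp Primrec.snd)
  exact Primrec.nat_div.comp (Primrec.nat_sub.comp
    (Primrec.nat_add.comp (Primrec.nat_mul.comp h1 h3) h2) (Primrec.const 1)) h2

theorem primrec_allocatedOutput :
    Primrec fun x : (BinStr × ℕ × ℕ) × (ℕ × BinStr) => allocatedOutput x.1.1 x.1.2 x.2 := by
  have hp : Primrec fun x : (BinStr × ℕ × ℕ) × (ℕ × BinStr) => x.1.1 :=
    Primrec.fst.comp Primrec.fst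
  have hl : Primrec fun x : (BinStr × ℕ × ℕ) × (ℕ × BinStr) => x.2.1 :=
    Primrec.fst.comp Primrec.snd
  exact Primrec.ite ((Primrec.eq.comp (Primrec.list_length.comp hp) (Primrec.succ.comp hl)).and
    (Primrec.eq.comp (primrec_readBits_zero.comp hp)
      (primrec_allocated.comp (Primrec.snd.comp Primrec.fst) hl)))
    (Primrec.option_some.comp (Primrec.snd.comp Primrec.snd)) (Primrec.const none)

theorem primrec_addRequest : Primrec₂ addRequest := by
  refine Primrec.option_casesOn Primrec.snd Primrec.fst ?_
  have ha : Primrec fun x : ((ℕ × ℕ) × Option (ℕ × BinStr)) × (ℕ × BinStr) => x.1.1 :=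
    Primrec.fst.comp Primrec.fst
  have hp : Primrec fun x : ((ℕ × ℕ) × Option (ℕ × BinStr)) × (ℕ × BinStr) => 2 ^ x.2.1 :=
    primrec_two_pow.comp (Primrec.fst.comp Primrec.snd)
  exact (Primrec.nat_add.comp (Primrec.nat_mul.comp (Primrec.fst.comp ha) hp)
    (Primrec.snd.comp ha)).pair (Primrec.nat_mul.comp (Primrec.snd.comp ha) hp)

theorem computable_partialWeight {r : ℕ → Option (ℕ × BinStr)} (hr : Computable r) :
    Computable (partialWeight r) := by
  have hs : Computable₂ fun (_ : ℕ) (x : ℕ × (ℕ × ℕ)) => addRequest x.2 (r x.1) :=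
    primrec_addRequest.to_comp.comp (Computable.snd.comp Computable.snd)
      (hr.comp (Computable.fst.comp Computable.snd))
  refine (Computable.nat_rec Computable.id (Computable.const ((0, 1) : ℕ × ℕ)) hs).of_eq
    fun i => ?_
  induction i with
  | zero => rfl
  | succ i ih => exact congrArg (addRequest · (r i)) ih

theorem computable_requestOutput {r : ℕ → Option (ℕ × BinStr)} (hr : Computable r) :
    Computable₂ (requestOutput r) := by
  refine Computable.option_bind (hr.comp Computable.snd) ?_
  have hg : Computable fun x : (BinStr × ℕ) × (ℕ × BinStr) =>
      ((x.1.1, partialWeight r x.1.2), x.2) :=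
    ((Computable.fst.comp Computable.fst).pair
      ((computable_partialWeight hr).comp (Computable.snd.comp Computable.fst))).pair
        Computable.snd
  have h := primrec_allocatedOutput.to_comp.comp hg
  exact h

theorem partialWeight_spec (r : ℕ → Option (ℕ × BinStr)) (i : ℕ) :
    0 < (partialWeight r i).2 ∧ ((partialWeight r i).1 : ℝ) =
      (partialWeight r i).2 * ∑ j ∈ Finset.range i, (requestWeight (r j) : ℝ) := by
  induction i with
  | zero => simp [partialWeight]
  | succ i ih =>
    obtain ⟨h1, h2⟩ := ih
    rw [partialWeight, Finset.sum_range_succ]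
    cases hr : r i with
    | none => simpa using ⟨h1, h2⟩
    | some y =>
      refine ⟨Nat.mul_pos h1 (by positivity), ?_⟩
      have h : (2 : ℝ) ^ y.1 * 2⁻¹ ^ y.1 = 1 := by rw [← mul_pow]; norm_num
      simp only [addRequest, requestWeight_some, NNReal.coe_pow, NNReal.coe_inv,
        NNReal.coe_ofNat]
      push_cast
      rw [h2]
      linear_combination -((partialWeight r i).2 : ℝ) * h

theorem requestOutput_spec {r : ℕ → Option (ℕ × BinStr)} {p s : BinStr} {i : ℕ} :
    requestOutput r p i = some s ↔ ∃ l, r i = some (l, s) ∧ p.length = l + 1 ∧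
      readBits 0 p = allocated (partialWeight r i) l := by
  unfold requestOutput
  rw [Option.bind_eq_some_iff]
  constructor
  · rintro ⟨⟨l, t⟩, h1, h2⟩
    simp only [allocatedOutput, Option.ite_none_right_eq_some, Option.some.injEq] at h2
    obtain ⟨⟨h2, h3⟩, rfl⟩ := h2
    exact ⟨l, h1, h2, h3⟩
  · rintro ⟨l, h1, h2⟩
    exact ⟨(l, s), h1, by simpa [allocatedOutput] using h2⟩

/-- The dyadic interval allocated to the request with index `i` lies between the partial sums of
the weights below `i` and below `i + 1`. -/
theorem allocated_bounds (r : ℕ → Option (ℕ × BinStr)) {i l : ℕ} {s : BinStr}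
    (h : r i = some (l, s)) :
    ∑ j ∈ Finset.range i, (requestWeight (r j) : ℝ) ≤
        allocated (partialWeight r i) l * 2⁻¹ ^ (l + 1) ∧
      (allocated (partialWeight r i) l + 1) * (2⁻¹ : ℝ) ^ (l + 1) <
        ∑ j ∈ Finset.range (i + 1), (requestWeight (r j) : ℝ) := by
  obtain ⟨hD, hA⟩ := partialWeight_spec r i
  rw [Finset.sum_range_succ]
  have hw : (requestWeight (r i) : ℝ) = 2 * 2⁻¹ ^ (l + 1) := by
    simp only [h, requestWeight_some, NNReal.coe_pow, NNReal.coe_inv, NNReal.coe_ofNat, pow_succ]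
    ring
  rw [hw]
  set a := ∑ j ∈ Finset.range i, (requestWeight (r j) : ℝ)
  set A := (partialWeight r i).1
  set D := (partialWeight r i).2
  set x := allocated (partialWeight r i) l
  have hx1 : x * D < A * 2 ^ (l + 1) + D := by
    have : x * D ≤ A * 2 ^ (l + 1) + D - 1 := Nat.div_mul_le_self _ _
    omega
  have hx2 : A * 2 ^ (l + 1) ≤ x * D := by
    have : A * 2 ^ (l + 1) + D - 1 < D * (x + 1) := Nat.lt_mul_div_succ _ hD
    rw [mul_add, mul_comm D x] at this
    omega
  have hx1' : (x : ℝ) * D < A * 2 ^ (l + 1) + D := by exact_mod_cast hx1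
  have hx2' : (A : ℝ) * 2 ^ (l + 1) ≤ x * D := by exact_mod_cast hx2
  have hD' : (0 : ℝ) < D := by exact_mod_cast hD
  rw [hA] at hx1' hx2'
  have h1 : a * 2 ^ (l + 1) ≤ x := le_of_mul_le_mul_left (by linarith) hD'
  have h2 : (x : ℝ) < a * 2 ^ (l + 1) + 1 := lt_of_mul_lt_mul_left (by linarith) hD'.le
  have hp : (0 : ℝ) < 2⁻¹ ^ (l + 1) := by positivity
  have hpp : (2 : ℝ) ^ (l + 1) * 2⁻¹ ^ (l + 1) = 1 := by rw [← mul_pow]; norm_num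
  have ha : a = a * 2 ^ (l + 1) * 2⁻¹ ^ (l + 1) := by rw [mul_assoc, hpp, mul_one]
  constructor
  · rw [ha]
    exact mul_le_mul_of_nonneg_right h1 hp.le
  · rw [ha, ← add_mul]
    exact mul_lt_mul_of_pos_right (by linarith) hp

/-- Strings allocated to different requests are incomparable, because their dyadic intervals are
disjoint. -/
theorem requestOutput_index_unique {r : ℕ → Option (ℕ × BinStr)} {p q s t : BinStr} {i j : ℕ}
    (hp : requestOutput r p i = some s) (hq : requestOutput r q j = some t) (hpq : p <+: q) :
    i = j := by
  obtain ⟨l, hi, hpl, hpx⟩ := requestOutput_spec.mp hp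
  obtain ⟨m, hj, hqm, hqx⟩ := requestOutput_spec.mp hq
  obtain ⟨h1, h2⟩ := allocated_bounds r hi
  obtain ⟨h3, h4⟩ := allocated_bounds r hj
  obtain ⟨h5, h6⟩ := leftEnd_of_prefix hpq
  have hmono : Monotone fun i => ∑ j ∈ Finset.range i, (requestWeight (r j) : ℝ) :=
    Finset.sum_mono_set_of_nonneg (fun _ => NNReal.coe_nonneg _) |>.comp Finset.range_mono
  unfold leftEnd at h5 h6
  rw [hpl, hpx, hqm, hqx] at h5 h6
  rw [add_mul, one_mul] at h2 h4
  have hm : (0 : ℝ) < 2⁻¹ ^ (m + 1) := by positivity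
  rcases lt_trichotomy i j with hij | hij | hij
  · have := hmono (Nat.succ_le_of_lt hij)
    simp only [Nat.succ_eq_add_one] at this
    linarith
  · exact hij
  · have := hmono (Nat.succ_le_of_lt hij)
    simp only [Nat.succ_eq_add_one] at this
    linarith

/-- An effective converse of Kraft's inequality: a computable list of requests of total weight
at most one is fulfilled by a prefix-free machine, up to one additional bit per program. The
additional bit makes it possible to allocate to each request a dyadic interval between two
consecutive partial sums of the weights. -/
theorem exists_machine_of_requests {r : ℕ → Option (ℕ × BinStr)} (hr : Computable r)
    (hw : ∑' i, (requestWeight (r i) : ℝ≥0∞) ≤ 1) :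
    ∃ C : BinStr →. BinStr, IsPrefixFreeMachine C ∧
      ∀ i l s, r i = some (l, s) → ∃ p : BinStr, p.length = l + 1 ∧ s ∈ C p := by
  refine ⟨fun p => Nat.rfindOpt (requestOutput r p),
    ⟨Partrec.rfindOpt (computable_requestOutput hr), ?_⟩, ?_⟩
  · intro p hp q hq hpq
    obtain ⟨i, s, hi⟩ := Nat.rfindOpt_dom.mp hp
    obtain ⟨j, t, hj⟩ := Nat.rfindOpt_dom.mp hq
    have hij := requestOutput_index_unique hi hj hpq
    subst hij
    obtain ⟨l, hl, hpl, -⟩ := requestOutput_spec.mp hi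
    obtain ⟨m, hm, hqm, -⟩ := requestOutput_spec.mp hj
    rw [hl, Option.some.injEq, Prod.mk.injEq] at hm
    exact hpq.eq_of_length (by rw [hpl, hqm, hm.1])
  · intro i l s hi
    have hsum : ∑ j ∈ Finset.range (i + 1), (requestWeight (r j) : ℝ) ≤ 1 := by
      have := (ENNReal.sum_le_tsum (Finset.range (i + 1))).trans hw
      exact_mod_cast this
    have hlt : allocated (partialWeight r i) l < 2 ^ (l + 1) := by
      have h := (allocated_bounds r hi).2.trans_le hsum
      rw [inv_pow, ← div_eq_mul_inv, div_lt_one (by positivity)] at h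
      have h' : allocated (partialWeight r i) l + 1 < 2 ^ (l + 1) := by exact_mod_cast h
      omega
    obtain ⟨p, hpl, hpx⟩ := exists_readBits_eq _ _ hlt
    have hp : requestOutput r p i = some s := requestOutput_spec.mpr ⟨l, hi, hpl, hpx⟩
    refine ⟨p, hpl, mem_rfindOpt_of_unique hp fun m x hx => ?_⟩
    have him := requestOutput_index_unique hp hx (List.prefix_refl p)
    subst him
    rw [Option.mem_def, hp] at hx
    exact (Option.some.inj hx).symm

/-! ### Two constructions of machines -/

/-- The machine that runs `U` on `p` for the input `0p`, and `W` on `p` for the input `1p`. -/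
def branch (U W : BinStr →. BinStr) : BinStr →. BinStr := fun r =>
  (r.head? : Part Bool).bind fun x => cond x (W r.tail) (U r.tail)

@[simp] theorem branch_nil (U W : BinStr →. BinStr) : branch U W [] = Part.none := by
  simp [branch]

@[simp] theorem branch_false (U W : BinStr →. BinStr) (p : BinStr) :
    branch U W (false :: p) = U p := by
  simp [branch]

@[simp] theorem branch_true (U W : BinStr →. BinStr) (p : BinStr) :
    branch U W (true :: p) = W p := by
  simp [branch]

theorem isPrefixFreeMachine_branch {U W : BinStr →. BinStr} (hU : IsPrefixFreeMachine U)
    (hW : IsPrefixFreeMachine W) : IsPrefixFreeMachine (branch U W) where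
  partrec := by
    refine Partrec.bind Primrec.list_head?.to_comp.ofOption ?_
    have ht : Computable fun x : BinStr × Bool => x.1.tail :=
      Primrec.list_tail.to_comp.comp Computable.fst
    exact Partrec.cond Computable.snd (hW.partrec.comp ht) (hU.partrec.comp ht)
  prefixFree := by
    intro p hp q hq hpq
    rcases p with _ | ⟨x, p⟩
    · simp [PFun.Dom] at hp
    rcases q with _ | ⟨y, q⟩
    · simp [PFun.Dom] at hq
    obtain ⟨rfl, hpq'⟩ := List.cons_prefix_cons.mp hpq
    cases x
    · simp only [PFun.mem_dom, branch_false] at hp hq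
      rw [hU.prefixFree p ((PFun.mem_dom _ _).mpr hp) q ((PFun.mem_dom _ _).mpr hq) hpq']
    · simp only [PFun.mem_dom, branch_true] at hp hq
      rw [hW.prefixFree p ((PFun.mem_dom _ _).mpr hp) q ((PFun.mem_dom _ _).mpr hq) hpq']

theorem isOptimal_branch {U W : BinStr →. BinStr} (hU : IsOptimal U)
    (hW : IsPrefixFreeMachine W) : IsOptimal (branch U W) where
  machine := isPrefixFreeMachine_branch hU.machine hW
  optimal C hC := by
    obtain ⟨d, hd⟩ := hU.optimal C hC
    refine ⟨d + 1, fun p hp => ?_⟩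
    obtain ⟨q, hq, hql⟩ := hd p hp
    exact ⟨false :: q, by rw [branch_false, hq], by simp; omega⟩

/-- Padding of programs: if a program `p` of `U` computes a string that `g` decodes to `(m, s)`,
then each extension of `p` to a string of length `m` becomes a program for `s`. -/
theorem exists_padded_machine {U : BinStr →. BinStr} (hU : IsPrefixFreeMachine U)
    {g : BinStr → ℕ × BinStr} (hg : Computable g) :
    ∃ W : BinStr →. BinStr, IsPrefixFreeMachine W ∧
      ∀ q s, s ∈ W q ↔ ∃ p y, p <+: q ∧ y ∈ U p ∧ g y = (q.length, s) := by
  obtain ⟨e, he, hmem, -⟩ := exists_primrec_enumeration hU.partrec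
  let f : BinStr → ℕ → Option BinStr := fun q i =>
    (e i).bind fun x => if q.take x.1.length = x.1 then some x.2 else none
  have hf : Primrec₂ f := by
    refine Primrec.option_bind (he.comp Primrec.snd) ?_
    refine Primrec.ite ?_ (Primrec.option_some.comp (Primrec.snd.comp Primrec.snd))
      (Primrec.const none)
    exact Primrec.eq.comp (Primrec.list_take.comp
      (Primrec.list_length.comp (Primrec.fst.comp Primrec.snd))
      (Primrec.fst.comp Primrec.fst)) (Primrec.fst.comp Primrec.snd)
  have hf' : ∀ q i y, f q i = some y ↔ ∃ p, e i = some (p, y) ∧ p <+: q := by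
    intro q i y
    simp only [f, Option.bind_eq_some_iff, Option.ite_none_right_eq_some, Option.some.injEq,
      Prod.exists]
    constructor
    · rintro ⟨p, y, h1, h2, rfl⟩
      exact ⟨p, h1, List.prefix_iff_eq_take.mpr h2.symm⟩
    · rintro ⟨p, h1, h2⟩
      exact ⟨p, y, h1, (List.prefix_iff_eq_take.mp h2).symm, rfl⟩
  have huniq : ∀ {q q' p p' y y' : BinStr}, q <+: q' → y ∈ U p → y' ∈ U p' → p <+: q →
      p' <+: q' → y = y' := by
    intro q q' p p' y y' hqq hy hy' hp hp'
    have hd := Part.dom_iff_mem.mpr ⟨y, hy⟩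
    have hd' := Part.dom_iff_mem.mpr ⟨y', hy'⟩
    have : p = p' := by
      rcases List.prefix_or_prefix_of_prefix (hp.trans hqq) hp' with h | h
      · exact hU.prefixFree p hd p' hd' h
      · exact (hU.prefixFree p' hd' p hd h).symm
    subst this
    exact Part.mem_unique hy hy'
  let W : BinStr →. BinStr := fun q => (Nat.rfindOpt (f q)).bind fun y =>
    ((if q.length = (g y).1 then some (g y).2 else none : Option BinStr) : Part BinStr)
  have hW : ∀ q s, s ∈ W q ↔ ∃ p y, p <+: q ∧ y ∈ U p ∧ g y = (q.length, s) := by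
    intro q s
    simp only [W, Part.mem_bind_iff]
    constructor
    · rintro ⟨y, hy, hs⟩
      obtain ⟨i, hi⟩ := Nat.rfindOpt_spec hy
      obtain ⟨p, hp, hpq⟩ := (hf' _ _ _).mp hi
      refine ⟨p, y, hpq, (hmem _ _).mpr ⟨i, hp⟩, ?_⟩
      simp only [Part.mem_ofOption, Option.mem_def, Option.ite_none_right_eq_some,
        Option.some.injEq] at hs
      exact Prod.ext hs.1.symm hs.2
    · rintro ⟨p, y, hpq, hy, hgy⟩
      obtain ⟨i, hi⟩ := (hmem _ _).mp hy
      refine ⟨y, mem_rfindOpt_of_unique ((hf' _ _ _).mpr ⟨p, hi, hpq⟩) ?_, by simp [hgy]⟩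
      intro m x hx
      obtain ⟨p', hp', hpq'⟩ := (hf' _ _ _).mp hx
      exact huniq (List.prefix_refl q) ((hmem _ _).mpr ⟨m, hp'⟩) hy hpq' hpq
  refine ⟨W, ⟨?_, ?_⟩, hW⟩
  · refine Partrec.bind (Partrec.rfindOpt hf.to_comp) ?_
    have hgy : Computable fun x : BinStr × BinStr => g x.2 := hg.comp Computable.snd
    have h : Computable fun x : BinStr × BinStr => decide (x.1.length = (g x.2).1) :=
      Primrec.eq.decide.to_comp.comp (Primrec.list_length.to_comp.comp Computable.fst)
        (Computable.fst.comp hgy)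
    refine Computable.ofOption ((Computable.cond h
      (Computable.option_some.comp (Computable.snd.comp hgy)) (Computable.const none)).of_eq ?_)
    intro x
    by_cases h : x.1.length = (g x.2).1 <;> simp [h]
  · intro q hq q' hq' hqq
    obtain ⟨s, hs⟩ := Part.dom_iff_mem.mp hq
    obtain ⟨s', hs'⟩ := Part.dom_iff_mem.mp hq'
    obtain ⟨p, y, hpq, hy, hgy⟩ := (hW _ _).mp hs
    obtain ⟨p', y', hpq', hy', hgy'⟩ := (hW _ _).mp hs'
    have := huniq hqq hy hy' hpq hpq'
    subst this
    rw [hgy, Prod.mk.injEq] at hgy'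
    exact hqq.eq_of_length hgy'.1

/-! ### The number of programs of bounded length -/

theorem tsum_pow_of_le (m : ℕ) :
    ∑' n : ℕ, (if m ≤ n then (2⁻¹ : ℝ≥0∞) ^ (n + 1) else 0) = 2⁻¹ ^ m := by
  have h : ∑' n : ℕ, (if m ≤ n then (2⁻¹ : ℝ≥0∞) ^ (n + 1) else 0)
      = ∑' n : ℕ, (2⁻¹ : ℝ≥0∞) ^ m * 2⁻¹ ^ (n + 1) := by
    have hinj : Function.Injective fun n : ℕ => n + m := fun a b h => by simpa using h
    rw [← hinj.tsum_eq]
    · refine tsum_congr fun n => ?_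
      rw [if_pos (by omega), ← pow_add]
      congr 1
      omega
    · intro n hn
      rw [Function.mem_support] at hn
      by_cases hmn : m ≤ n
      · exact ⟨n - m, by simp only; omega⟩
      · simp [hmn] at hn
  rw [h, ENNReal.tsum_mul_left, ENNReal.tsum_geometric_add_one]
  simp [ENNReal.inv_mul_cancel]

theorem tsum_two_pow_of_le (N : ℕ) :
    ∑' k : ℕ, (if 2 ^ k ≤ N then (2 : ℝ≥0∞) ^ k else 0) ≤ 2 * N := by
  by_cases hN : N = 0
  · subst hN
    simp
  have hsupp : ∀ k ∉ Finset.range (Nat.log 2 N + 1),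
      (if 2 ^ k ≤ N then (2 : ℝ≥0∞) ^ k else 0) = 0 := by
    intro k hk
    rw [if_neg]
    intro h
    have := Nat.le_log_of_pow_le (by norm_num) h
    simp at hk
    omega
  rw [tsum_eq_sum hsupp]
  have h1 : ∑ k ∈ Finset.range (Nat.log 2 N + 1), 2 ^ k ≤ 2 * N := by
    have h2 := Nat.pow_log_le_self 2 hN
    have h3 := Nat.geomSum_eq (m := 2) le_rfl (Nat.log 2 N + 1)
    rw [h3, pow_succ]
    omega
  calc _ ≤ ∑ k ∈ Finset.range (Nat.log 2 N + 1), (2 : ℝ≥0∞) ^ k := by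
        refine Finset.sum_le_sum fun k _ => ?_
        split_ifs <;> simp
    _ ≤ 2 * N := by exact_mod_cast h1

theorem codewords_encard (C : BinStr →. BinStr) (n : ℕ) (s : BinStr) :
    ((codewords C n s).ncard : ℝ≥0∞) = ∑' p, (codewords C n s).indicator 1 p := by
  classical
  rw [tsum_eq_sum (s := (codewords_finite C n s).toFinset) (fun p hp => by
    rw [Set.indicator_of_notMem]; simpa using hp)]
  rw [Finset.sum_congr rfl (g := fun _ => (1 : ℝ≥0∞)) (fun p hp => by
    rw [Set.indicator_of_mem]; · rfl
    simpa using hp)]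
  rw [Set.ncard_eq_toFinset_card _ (codewords_finite C n s)]
  simp

/-- Each program `p` contributes `2^{-n-1}` for each `n ≥ |p|`, altogether `2^{-|p|}`. -/
theorem tsum_ncard_codewords_le_one {C : BinStr →. BinStr} (hC : PrefixFree C.Dom) :
    ∑' n : ℕ, ∑' s, ((codewords C n s).ncard : ℝ≥0∞) * 2⁻¹ ^ (n + 1) ≤ 1 := by
  classical
  refine le_trans (le_of_eq ?_) hC.tsum_le_one
  have h1 : ∀ n : ℕ, ∑' s, ((codewords C n s).ncard : ℝ≥0∞) * 2⁻¹ ^ (n + 1) =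
      ∑' p : BinStr, C.Dom.indicator
        (fun p : BinStr => if p.length ≤ n then (2⁻¹ : ℝ≥0∞) ^ (n + 1) else 0) p := by
    intro n
    simp_rw [codewords_encard, ← ENNReal.tsum_mul_right]
    rw [ENNReal.tsum_comm]
    refine tsum_congr fun p => ?_
    by_cases hp : p ∈ C.Dom
    · obtain ⟨s, hs⟩ := Part.dom_iff_mem.mp hp
      rw [tsum_eq_single s, Set.indicator_of_mem hp]
      · by_cases hl : p.length ≤ n <;> simp [Set.indicator, codewords, hl, hs]
      · intro t ht
        have : p ∉ codewords C n t := fun h => ht (Part.mem_unique h.2 hs)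
        simp [this]
    · rw [Set.indicator_of_notMem hp]
      refine ENNReal.tsum_eq_zero.mpr fun s => ?_
      have : p ∉ codewords C n s := fun h => hp (Part.dom_iff_mem.mpr ⟨s, h.2⟩)
      simp [this]
  simp_rw [h1]
  rw [ENNReal.tsum_comm]
  refine tsum_congr fun p => ?_
  by_cases hp : p ∈ C.Dom
  · simp_rw [Set.indicator_of_mem hp]
    exact tsum_pow_of_le _
  · simp [Set.indicator_of_notMem hp]

theorem ncard_codewords_le {C : BinStr →. BinStr} (hC : PrefixFree C.Dom) (n : ℕ) (s : BinStr) :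
    (codewords C n s).ncard ≤ 2 ^ n := by
  have hF : PrefixFree ((codewords_finite C n s).toFinset : Set BinStr) := hC.mono fun p hp => by
    simp only [Set.Finite.coe_toFinset] at hp
    exact Part.dom_iff_mem.mpr ⟨s, hp.2⟩
  have h1 : ∑ _p ∈ (codewords_finite C n s).toFinset, (2⁻¹ : ℝ) ^ n ≤ 1 := by
    refine le_trans (Finset.sum_le_sum fun p hp => ?_) hF.sum_le_one
    simp only [Set.Finite.mem_toFinset] at hp
    exact pow_le_pow_of_le_one (by norm_num) (by norm_num) hp.1
  rw [Finset.sum_const, ← Set.ncard_eq_toFinset_card _ (codewords_finite C n s), nsmul_eq_mul,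
    inv_pow, ← div_eq_mul_inv, div_le_one (by positivity)] at h1
  exact_mod_cast h1

/-! ### The upper bound -/

/-- Whether the enumeration `e` of the graph of a machine lists, at the index `i`, a program for
`s` of length at most `n`. -/
def isHit (e : ℕ → Option (BinStr × BinStr)) (n : ℕ) (s : BinStr) (i : ℕ) : Bool :=
  (e i).elim false fun x => decide (x.1.length ≤ n) && decide (x.2 = s)

theorem isHit_iff {e : ℕ → Option (BinStr × BinStr)} {n : ℕ} {s : BinStr} {i : ℕ} :
    isHit e n s i = true ↔ ∃ p, e i = some (p, s) ∧ p.length ≤ n := by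
  unfold isHit
  cases h : e i with
  | none => simp
  | some x =>
    obtain ⟨p, t⟩ := x
    simp only [Option.elim_some, Bool.and_eq_true, decide_eq_true_eq, Option.some.injEq,
      Prod.mk.injEq]
    exact ⟨fun h => ⟨p, ⟨rfl, h.2⟩, h.1⟩, by rintro ⟨p, ⟨rfl, rfl⟩, h⟩; exact ⟨h, rfl⟩⟩

/-- The number of hits with index below `i`. -/
def hitCount (e : ℕ → Option (BinStr × BinStr)) (n : ℕ) (s : BinStr) (i : ℕ) : ℕ :=
  Nat.count (fun j => isHit e n s j = true) i

theorem primrec_isHit {e : ℕ → Option (BinStr × BinStr)} (he : Primrec e) :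
    Primrec fun x : (ℕ × BinStr) × ℕ => isHit e x.1.1 x.1.2 x.2 := by
  have h : Primrec fun x : (ℕ × BinStr) × ℕ =>
      ((e x.2).map fun y => decide (y.1.length ≤ x.1.1) && decide (y.2 = x.1.2)).getD false := by
    refine Primrec.option_getD.comp (Primrec.option_map (he.comp Primrec.snd) ?_)
      (Primrec.const false)
    refine Primrec.and.comp (Primrec.nat_le.decide.comp
      (Primrec.list_length.comp (Primrec.fst.comp Primrec.snd))
      (Primrec.fst.comp (Primrec.fst.comp Primrec.fst))) ?_
    exact Primrec.eq.decide.comp (Primrec.snd.comp Primrec.snd)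
      (Primrec.snd.comp (Primrec.fst.comp Primrec.fst))
  refine h.of_eq fun x => ?_
  unfold isHit
  cases e x.2 <;> simp

theorem primrec_hitCount {e : ℕ → Option (BinStr × BinStr)} (he : Primrec e) :
    Primrec fun x : (ℕ × BinStr) × ℕ => hitCount e x.1.1 x.1.2 x.2 := by
  have hg : Primrec₂ fun (x : (ℕ × BinStr) × ℕ) (y : ℕ × ℕ) =>
      y.2 + (isHit e x.1.1 x.1.2 y.1).toNat :=
    Primrec.nat_add.comp (Primrec.snd.comp Primrec.snd) ((Primrec.dom_bool Bool.toNat).comp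
      ((primrec_isHit he).comp ((Primrec.fst.comp Primrec.fst).pair
        (Primrec.fst.comp Primrec.snd))))
  refine (Primrec.nat_rec' Primrec.snd (Primrec.const 0) hg).of_eq fun x => ?_
  obtain ⟨a, i⟩ := x
  change Nat.rec (motive := fun _ => ℕ) 0 (fun j c => c + (isHit e a.1 a.2 j).toNat) i =
    hitCount e a.1 a.2 i
  induction i with
  | zero => simp [hitCount]
  | succ i ih =>
    change Nat.rec (motive := fun _ => ℕ) 0 (fun j c => c + (isHit e a.1 a.2 j).toNat) i + _ = _
    rw [ih, hitCount, hitCount, Nat.count_succ]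
    cases isHit e a.1 a.2 i <;> simp

/-- The hits for `n` and `s` correspond to the programs in `S_C(n, s)`, as the enumeration is
repetition-free. -/
theorem exists_finset_hits {C : BinStr →. BinStr} {e : ℕ → Option (BinStr × BinStr)}
    (hmem : ∀ p s, s ∈ C p ↔ ∃ i, e i = some (p, s))
    (hinj : ∀ i j x, e i = some x → e j = some x → i = j) (n : ℕ) (s : BinStr) :
    ∃ F : Finset ℕ, (∀ i, i ∈ F ↔ isHit e n s i = true) ∧ F.card = (codewords C n s).ncard := by
  classical
  have hidx : ∀ p ∈ (codewords_finite C n s).toFinset, ∃ i, e i = some (p, s) := fun p hp =>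
    (hmem p s).mp (by simpa using ((Set.Finite.mem_toFinset _).mp hp).2)
  choose! idx hidx using hidx
  refine ⟨(codewords_finite C n s).toFinset.image idx, fun i => ?_, ?_⟩
  · rw [isHit_iff, Finset.mem_image]
    constructor
    · rintro ⟨p, hp, rfl⟩
      exact ⟨p, hidx p hp, ((Set.Finite.mem_toFinset _).mp hp).1⟩
    · rintro ⟨p, hi, hl⟩
      have hp : p ∈ (codewords_finite C n s).toFinset :=
        (Set.Finite.mem_toFinset _).mpr ⟨hl, (hmem p s).mpr ⟨i, hi⟩⟩
      exact ⟨p, hp, hinj _ _ _ (hidx p hp) hi⟩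
  · rw [Finset.card_image_of_injOn, ← Set.ncard_eq_toFinset_card _ (codewords_finite C n s)]
    intro p hp q hq hpq
    have h1 := hidx p hp
    rw [show idx p = idx q from hpq, hidx q hq] at h1
    simpa using h1.symm

theorem hitCount_le {C : BinStr →. BinStr} {e : ℕ → Option (BinStr × BinStr)}
    (hmem : ∀ p s, s ∈ C p ↔ ∃ i, e i = some (p, s))
    (hinj : ∀ i j x, e i = some x → e j = some x → i = j) (n : ℕ) (s : BinStr) (i : ℕ) :
    hitCount e n s i ≤ (codewords C n s).ncard := by
  obtain ⟨F, hF, hcard⟩ := exists_finset_hits hmem hinj n s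
  rw [hitCount, Nat.count_eq_card_filter_range, ← hcard]
  exact Finset.card_le_card fun j hj => (hF j).mpr (Finset.mem_filter.mp hj).2

theorem exists_hit_hitCount_eq {C : BinStr →. BinStr} {e : ℕ → Option (BinStr × BinStr)}
    (hmem : ∀ p s, s ∈ C p ↔ ∃ i, e i = some (p, s))
    (hinj : ∀ i j x, e i = some x → e j = some x → i = j) (n : ℕ) (s : BinStr) (m : ℕ)
    (hm : m < (codewords C n s).ncard) :
    ∃ i, isHit e n s i = true ∧ hitCount e n s i = m := by
  obtain ⟨F, hF, hcard⟩ := exists_finset_hits hmem hinj n s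
  have hset : Set.ofPred (fun j => isHit e n s j = true) = F := by
    ext i
    exact (hF i).symm
  have hfin : (Set.ofPred (fun j => isHit e n s j = true)).Finite := hset ▸ F.finite_toSet
  have hlt : ∀ hf : (Set.ofPred (fun j => isHit e n s j = true)).Finite, m < hf.toFinset.card := by
    intro hf
    rw [← Set.ncard_eq_toFinset_card _ hf, hset, Set.ncard_coe_finset, hcard]
    exact hm
  exact ⟨Nat.nth (fun j => isHit e n s j = true) m, Nat.nth_mem m hlt, Nat.count_nth hlt⟩

theorem hit_eq_of_hitCount_eq {e : ℕ → Option (BinStr × BinStr)} {n : ℕ} {s : BinStr} {i j : ℕ}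
    (hi : isHit e n s i = true) (hj : isHit e n s j = true)
    (h : hitCount e n s i = hitCount e n s j) : i = j :=
  Nat.count_injective hi hj h

/-- The request that is made at the index `j` of the enumeration `e` for the length bound `n` and
the exponent `k`: it is present if the output at `j`, say `s`, has just received its `2^k`-th
program of length at most `n`, and it then asks for a program of length about `n - k` for the
pair `(n, s)`. The summand `2` in the requested length compensates the factors `2` that are lost in
the sum over `k` and in the sum over `n`, so that the total weight is at most one. -/
def hitRequest (e : ℕ → Option (BinStr × BinStr)) (j n k : ℕ) : Option (ℕ × ℕ × BinStr) :=
  (e j).bind fun x =>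
    if isHit e n x.2 j = true ∧ hitCount e n x.2 j + 1 = 2 ^ k then some (n - k + 2, n, x.2)
    else none

theorem primrec_hitRequest {e : ℕ → Option (BinStr × BinStr)} (he : Primrec e) :
    Primrec fun x : ℕ × ℕ × ℕ => hitRequest e x.1 x.2.1 x.2.2 := by
  refine Primrec.option_bind (he.comp Primrec.fst) ?_
  have hj : Primrec fun x : (ℕ × ℕ × ℕ) × (BinStr × BinStr) => x.1.1 :=
    Primrec.fst.comp Primrec.fst
  have hn : Primrec fun x : (ℕ × ℕ × ℕ) × (BinStr × BinStr) => x.1.2.1 :=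
    Primrec.fst.comp (Primrec.snd.comp Primrec.fst)
  have hk : Primrec fun x : (ℕ × ℕ × ℕ) × (BinStr × BinStr) => x.1.2.2 :=
    Primrec.snd.comp (Primrec.snd.comp Primrec.fst)
  have hs : Primrec fun x : (ℕ × ℕ × ℕ) × (BinStr × BinStr) => x.2.2 :=
    Primrec.snd.comp Primrec.snd
  have h1 := (primrec_isHit he).comp ((hn.pair hs).pair hj)
  have h2 := (primrec_hitCount he).comp ((hn.pair hs).pair hj)
  exact Primrec.ite ((Primrec.eq.comp h1 (Primrec.const true)).and
    (Primrec.eq.comp (Primrec.succ.comp h2) (primrec_two_pow.comp hk)))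
    (Primrec.option_some.comp ((Primrec.nat_add.comp (Primrec.nat_sub.comp hn hk)
      (Primrec.const 2)).pair (hn.pair hs))) (Primrec.const none)

theorem hitRequest_eq_some {e : ℕ → Option (BinStr × BinStr)} {j n k : ℕ}
    {y : ℕ × ℕ × BinStr} : hitRequest e j n k = some y ↔ ∃ s, isHit e n s j = true ∧
      hitCount e n s j + 1 = 2 ^ k ∧ y = (n - k + 2, n, s) := by
  unfold hitRequest
  rw [Option.bind_eq_some_iff]
  constructor
  · rintro ⟨⟨p, s⟩, -, h⟩
    simp only [Option.ite_none_right_eq_some, Option.some.injEq] at h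
    exact ⟨s, h.1.1, h.1.2, h.2.symm⟩
  · rintro ⟨s, h1, h2, rfl⟩
    obtain ⟨p, hp, -⟩ := isHit_iff.mp h1
    exact ⟨(p, s), hp, by simp [h1, h2]⟩

theorem two_inv_pow_sub_le (n k : ℕ) :
    (2⁻¹ : ℝ≥0∞) ^ (n - k + 2) ≤ 2 ^ k * 2⁻¹ ^ (n + 2) := by
  have h : (2 : ℝ≥0∞) ^ k * 2⁻¹ ^ k = 1 := by
    rw [← mul_pow, ENNReal.mul_inv_cancel (by norm_num) (by norm_num), one_pow]
  calc (2⁻¹ : ℝ≥0∞) ^ (n - k + 2) = 2 ^ k * 2⁻¹ ^ (k + (n - k + 2)) := by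
        rw [pow_add _ k, ← mul_assoc, h, one_mul]
    _ ≤ 2 ^ k * 2⁻¹ ^ (n + 2) := by
        gcongr 2 ^ k * ?_
        exact pow_le_pow_right_of_le_one' (ENNReal.inv_le_one.mpr (by norm_num)) (by omega)

/-- For fixed `n` and `s`, the requests with exponent `k` are present only for the powers `2^k`
that do not exceed the number of programs, and only once each. -/
theorem tsum_hitRequest_le {C : BinStr →. BinStr} {e : ℕ → Option (BinStr × BinStr)}
    (hmem : ∀ p s, s ∈ C p ↔ ∃ i, e i = some (p, s))
    (hinj : ∀ i j x, e i = some x → e j = some x → i = j) (n k : ℕ) (s : BinStr) :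
    ∑' j, (if isHit e n s j = true ∧ hitCount e n s j + 1 = 2 ^ k
        then (2⁻¹ : ℝ≥0∞) ^ (n - k + 2) else 0) ≤
      (if 2 ^ k ≤ (codewords C n s).ncard then (2 : ℝ≥0∞) ^ k else 0) * 2⁻¹ ^ (n + 2) := by
  by_cases hex : ∃ j, isHit e n s j = true ∧ hitCount e n s j + 1 = 2 ^ k
  · obtain ⟨j, hj, hjk⟩ := hex
    rw [tsum_eq_single j, if_pos ⟨hj, hjk⟩, if_pos]
    · exact two_inv_pow_sub_le n k
    · have h1 : hitCount e n s (j + 1) = hitCount e n s j + 1 := by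
        rw [hitCount, Nat.count_succ, if_pos hj, hitCount]
      exact hjk ▸ h1 ▸ hitCount_le hmem hinj n s (j + 1)
    · intro i hi
      rw [if_neg]
      rintro ⟨h1, h2⟩
      exact hi (hit_eq_of_hitCount_eq h1 hj (by omega))
  · rw [ENNReal.tsum_eq_zero.mpr fun j => if_neg fun h => hex ⟨j, h⟩]
    exact zero_le

/-- The coding theorem for the numbers `#S_C(n, s)`: if there are at least `2^k` programs of length
at most `n` for `s`, then the pair `(n, s)` has a program of length about `n - k`. -/
theorem exists_machine_of_two_pow_le_ncard {C : BinStr →. BinStr} (hC : IsPrefixFreeMachine C)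
    {g : ℕ × BinStr → BinStr} (hg : Computable g) :
    ∃ D : BinStr →. BinStr, IsPrefixFreeMachine D ∧ ∀ n s k,
      2 ^ k ≤ (codewords C n s).ncard → ∃ p : BinStr, p.length = n - k + 3 ∧ g (n, s) ∈ D p := by
  obtain ⟨e, he, hmem, hinj⟩ := exists_primrec_enumeration hC.partrec
  let ρ : ℕ × ℕ × ℕ → Option (ℕ × BinStr) := fun x =>
    (hitRequest e x.1 x.2.1 x.2.2).map fun y => (y.1, g y.2)
  let φ : ℕ → ℕ × ℕ × ℕ := fun i => (i.unpair.1, i.unpair.2.unpair)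
  have hρ : Computable fun i => ρ (φ i) := by
    have hφ : Primrec φ := (Primrec.fst.comp Primrec.unpair).pair
      (Primrec.unpair.comp (Primrec.snd.comp Primrec.unpair))
    have h1 : Computable fun i => hitRequest e (φ i).1 (φ i).2.1 (φ i).2.2 :=
      ((primrec_hitRequest he).comp hφ).to_comp
    exact Computable.option_map h1 ((Computable.fst.comp Computable.snd).pair
      (hg.comp (Computable.snd.comp Computable.snd)))
  have hρw : ∀ j n k, (requestWeight (ρ (j, n, k)) : ℝ≥0∞) ≤
      ∑' s, (if isHit e n s j = true ∧ hitCount e n s j + 1 = 2 ^ k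
        then (2⁻¹ : ℝ≥0∞) ^ (n - k + 2) else 0) := by
    intro j n k
    cases h : hitRequest e j n k with
    | none => simp [ρ, h]
    | some y =>
      obtain ⟨s, h1, h2, rfl⟩ := hitRequest_eq_some.mp h
      refine le_trans (le_of_eq ?_) (ENNReal.le_tsum s)
      rw [if_pos ⟨h1, h2⟩]
      simp [ρ, h, ENNReal.inv_pow]
  have hw : ∑' i, (requestWeight (ρ (φ i)) : ℝ≥0∞) ≤ 1 := by
    calc ∑' i, (requestWeight (ρ (φ i)) : ℝ≥0∞)
        = ∑' n, ∑' k, ∑' j, (requestWeight (ρ (j, n, k)) : ℝ≥0∞) := by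
          have h1 : ∑' i, (requestWeight (ρ (φ i)) : ℝ≥0∞) =
              ∑' x : ℕ × ℕ, (requestWeight (ρ (x.1, x.2.unpair)) : ℝ≥0∞) :=
            Nat.pairEquiv.symm.tsum_eq
              fun x : ℕ × ℕ => (requestWeight (ρ (x.1, x.2.unpair)) : ℝ≥0∞)
          rw [h1, ENNReal.tsum_prod
            (f := fun j (m : ℕ) => (requestWeight (ρ (j, m.unpair)) : ℝ≥0∞)), ENNReal.tsum_comm]
          have h2 : ∑' m : ℕ, ∑' j, (requestWeight (ρ (j, m.unpair)) : ℝ≥0∞) =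
              ∑' x : ℕ × ℕ, ∑' j, (requestWeight (ρ (j, x)) : ℝ≥0∞) :=
            Nat.pairEquiv.symm.tsum_eq
              fun x : ℕ × ℕ => ∑' j, (requestWeight (ρ (j, x)) : ℝ≥0∞)
          rw [h2, ENNReal.tsum_prod
            (f := fun n k => ∑' j, (requestWeight (ρ (j, n, k)) : ℝ≥0∞))]
      _ ≤ ∑' n, ∑' k, ∑' s, (if 2 ^ k ≤ (codewords C n s).ncard then (2 : ℝ≥0∞) ^ k else 0) *
            2⁻¹ ^ (n + 2) := by
          refine ENNReal.tsum_le_tsum fun n => ENNReal.tsum_le_tsum fun k => ?_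
          refine (ENNReal.tsum_le_tsum fun j => hρw j n k).trans ?_
          rw [ENNReal.tsum_comm]
          exact ENNReal.tsum_le_tsum fun s => tsum_hitRequest_le hmem hinj n k s
      _ ≤ ∑' n : ℕ, ∑' s, ((codewords C n s).ncard : ℝ≥0∞) * 2⁻¹ ^ (n + 1) := by
          refine ENNReal.tsum_le_tsum fun n => ?_
          rw [ENNReal.tsum_comm]
          refine ENNReal.tsum_le_tsum fun s => ?_
          rw [ENNReal.tsum_mul_right]
          refine (mul_le_mul_left (tsum_two_pow_of_le _) _).trans (le_of_eq ?_)
          rw [pow_succ _ (n + 1), mul_comm (2 : ℝ≥0∞), mul_assoc, mul_comm _ (2⁻¹ : ℝ≥0∞),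
            ← mul_assoc 2, ENNReal.mul_inv_cancel (by norm_num) (by norm_num), one_mul]
      _ ≤ 1 := tsum_ncard_codewords_le_one hC.prefixFree
  obtain ⟨D, hD, hDreq⟩ := exists_machine_of_requests hρ hw
  refine ⟨D, hD, fun n s k hk => ?_⟩
  have hpos : 0 < 2 ^ k := by positivity
  obtain ⟨j, hj, hjk⟩ := exists_hit_hitCount_eq hmem hinj n s (2 ^ k - 1) (by omega)
  refine hDreq (Nat.pair j (Nat.pair n k)) (n - k + 2) _ ?_
  have h := hitRequest_eq_some.mpr ⟨s, hj, show hitCount e n s j + 1 = 2 ^ k by omega, rfl⟩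
  simp [ρ, φ, h]

theorem pairComplexity_le {U : BinStr →. BinStr} (b : BinStr × BinStr → BinStr) {n : ℕ}
    {s q : BinStr} (hq : b (strEquivNat.symm n, s) ∈ U q) : pairComplexity U b n s ≤ q.length := by
  have h : complexity U (b (strEquivNat.symm n, s)) ≤ q.length := iInf₂_le q hq
  simpa [pairComplexity] using ENat.toNat_le_toNat h (ENat.natCast_ne_top _)

theorem computable_strEquivNat : Computable strEquivNat := by
  have h : Primrec (readBits 1) :=
    (Primrec.list_foldl (h := fun (_ : BinStr) (y : ℕ × Bool) => 2 * y.1 + y.2.toNat)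
      Primrec.id (Primrec.const 1) (Primrec.nat_add.comp
        (Primrec.nat_mul.comp (Primrec.const 2) (Primrec.fst.comp Primrec.snd))
        ((Primrec.dom_bool Bool.toNat).comp (Primrec.snd.comp Primrec.snd)))).of_eq fun s => rfl
  exact (Primrec.nat_sub.comp h (Primrec.const 1)).to_comp

/-- The upper bound, which holds for every prefix-free machine `V`: if `2^k` is the largest power
of two not above `#S_V(n, s)`, then `H(n, s) ≤ n - k + O(1)`. -/
theorem exists_ncard_codewords_le {U V : BinStr →. BinStr} (hU : IsOptimal U)
    (hV : IsPrefixFreeMachine V) {b : BinStr × BinStr → BinStr} (hb : Computable b) :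
    ∃ d : ℕ, ∀ (n : ℕ) (s : BinStr), ((codewords V n s).ncard : ℝ) ≤
      (2 : ℝ) ^ ((n : ℤ) - (pairComplexity U b n s : ℤ) + (d : ℤ)) := by
  have hg : Computable fun x : ℕ × BinStr => b (strEquivNat.symm x.1, x.2) :=
    hb.comp (((computable_symm _ computable_strEquivNat).comp Computable.fst).pair Computable.snd)
  obtain ⟨D, hD, hDp⟩ := exists_machine_of_two_pow_le_ncard hV hg
  obtain ⟨d, hd⟩ := hU.optimal D hD
  refine ⟨d + 4, fun n s => ?_⟩
  by_cases h0 : (codewords V n s).ncard = 0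
  · rw [h0, Nat.cast_zero]
    exact zpow_nonneg zero_le_two _
  have hk := Nat.pow_log_le_self 2 h0
  have hk' := Nat.lt_pow_succ_log_self (b := 2) (by norm_num) (codewords V n s).ncard
  set k := Nat.log 2 (codewords V n s).ncard
  have hkn : k ≤ n := (Nat.pow_le_pow_iff_right (a := 2) (by norm_num)).mp
    (hk.trans (ncard_codewords_le hV.prefixFree n s))
  obtain ⟨p, hpl, hp⟩ := hDp n s k hk
  obtain ⟨q, hq, hql⟩ := hd p (Part.dom_iff_mem.mpr ⟨_, hp⟩)
  have hH := pairComplexity_le (U := U) b (n := n) (s := s) (hq ▸ hp)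
  calc ((codewords V n s).ncard : ℝ) ≤ (2 : ℝ) ^ (k + 1) := by exact_mod_cast hk'.le
    _ = (2 : ℝ) ^ ((k + 1 : ℕ) : ℤ) := (zpow_natCast _ _).symm
    _ ≤ _ := zpow_le_zpow_right₀ (by norm_num) (by push_cast; omega)

/-! ### The lower bound -/

theorem two_pow_le_ncard_codewords {V : BinStr →. BinStr} {n m : ℕ} {s r : BinStr}
    (hlen : r.length + m ≤ n) (hr : ∀ x : BinStr, x.length = m → s ∈ V (r ++ x)) :
    2 ^ m ≤ (codewords V n s).ncard := by
  have hinj : Function.Injective fun x : List.Vector Bool m => r ++ x.toList := fun x y h =>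
    Subtype.ext (List.append_cancel_left h)
  have h1 : (Set.range fun x : List.Vector Bool m => r ++ x.toList).ncard = 2 ^ m := by
    rw [← Set.image_univ, Set.ncard_image_of_injective _ hinj, Set.ncard_univ]
    simp [card_vector]
  rw [← h1]
  refine Set.ncard_le_ncard ?_ (codewords_finite V n s)
  rintro _ ⟨x, rfl⟩
  exact ⟨by simpa using hlen, hr _ x.toList_length⟩

/-- The machine `V` of the theorem runs `U` on `p` for the input `0p`; on the input `1q` it decodes
the output of the unique program `p` of `U` that is a prefix of `q` to a pair `(n, s)`, and
outputs `s` if `1q` has length `n`. A shortest program for `(n, s)` thus has all its extensions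
of length `n - 1` as programs for `s`. -/
theorem exists_optimal_two_pow_le_ncard {U : BinStr →. BinStr} (hU : IsOptimal U)
    {b : BinStr × BinStr → BinStr} (hb : Computable b) (hbij : Function.Bijective b) :
    ∃ V : BinStr →. BinStr, IsOptimal V ∧ ∀ n s, pairComplexity U b n s < n →
      2 ^ (n - 1 - pairComplexity U b n s) ≤ (codewords V n s).ncard := by
  have hinv := computable_symm (Equiv.ofBijective b hbij) hb
  -- The program for a pair `(n, s)` is padded to length `n - 1`, as one bit selects the branch.
  -- The truncation at `n = 0` is harmless, because no such pair enters the claim.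
  have hg : Computable fun y => (strEquivNat ((Equiv.ofBijective b hbij).symm y).1 - 1,
      ((Equiv.ofBijective b hbij).symm y).2) :=
    ((Primrec.pred.to_comp.comp
      (computable_strEquivNat.comp (Computable.fst.comp hinv)))).pair (Computable.snd.comp hinv)
  obtain ⟨W, hW, hWmem⟩ := exists_padded_machine hU.machine hg
  refine ⟨branch U W, isOptimal_branch hU hW, fun n s hn => ?_⟩
  obtain ⟨p, hp, hpl⟩ := hU.exists_length_eq_complexity (b (strEquivNat.symm n, s))
  have hH : pairComplexity U b n s = p.length := by
    rw [pairComplexity, hpl, ENat.toNat_natCast]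
  rw [hH] at hn ⊢
  refine two_pow_le_ncard_codewords (r := true :: p) (by simp; omega) fun x hx => ?_
  rw [List.cons_append, branch_true, hWmem]
  have hsymm : (Equiv.ofBijective b hbij).symm (b (strEquivNat.symm n, s)) =
      (strEquivNat.symm n, s) := (Equiv.ofBijective b hbij).symm_apply_apply _
  refine ⟨p, _, List.prefix_append p x, hp, ?_⟩
  simp only [hsymm, Equiv.apply_symm_apply, List.length_append, hx, Prod.mk.injEq, and_true]
  omega

end AIT

theorem mainTheorem1 (U : BinStr →. BinStr) (hU : IsOptimal U)
    (b : BinStr × BinStr → BinStr) (hb : Computable b) (hbij : Function.Bijective b) :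
    ∃ V : BinStr →. BinStr, IsOptimal V ∧ ∃ d : ℕ,
      (∀ (n : ℕ) (s : BinStr),
        ((codewords V n s).ncard : ℝ) ≤
          (2 : ℝ) ^ ((n : ℤ) - (pairComplexity U b n s : ℤ) + (d : ℤ))) ∧
      (∀ (n : ℕ) (s : BinStr), (d : ℤ) ≤ (n : ℤ) - (pairComplexity U b n s : ℤ) →
        (2 : ℝ) ^ ((n : ℤ) - (pairComplexity U b n s : ℤ) - (d : ℤ)) ≤
          ((codewords V n s).ncard : ℝ)) := by
  obtain ⟨V, hV, hlow⟩ := exists_optimal_two_pow_le_ncard hU hb hbij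
  obtain ⟨d, hup⟩ := exists_ncard_codewords_le hU hV.machine hb
  refine ⟨V, hV, d + 1, fun n s => (hup n s).trans ?_, fun n s hn => ?_⟩
  · exact zpow_le_zpow_right₀ (by norm_num) (by push_cast; omega)
  · push_cast at hn
    have h := hlow n s (by omega)
    calc (2 : ℝ) ^ ((n : ℤ) - (pairComplexity U b n s : ℤ) - ((d + 1 : ℕ) : ℤ))
        ≤ (2 : ℝ) ^ ((n - 1 - pairComplexity U b n s : ℕ) : ℤ) :=
          zpow_le_zpow_right₀ (by norm_num) (by push_cast; omega)
      _ = (2 : ℝ) ^ (n - 1 - pairComplexity U b n s) := zpow_natCast _ _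
      _ ≤ _ := by exact_mod_cast h
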